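/- Let $(W,w_0)$ be a well-pointed space (the inclusion of $w_0$ is a cofibration). Maps and homotopies are base point preserving, $[X,Y]$ denotes pointed homotopy classes, $\Sigma$ is the reduced suspension, and $[\Sigma A,X]$ has its usual group structure, $[f][g]=[(f,g)\circ\sigma_A]$ with $\sigma_A:\Sigma A\to\Sigma A\vee\Sigma A$ the suspension co-multiplication. For $n\ge 1$ put $\hat{\mathfrak F}_n=\Sigma(W^{n-1}\sqcup *)$, so that $\tau_{W^{n-1}}(X)=[\hat{\mathfrak F}_n,X]$, and $P_n=W^n/W^{n-1}$, where $W^{n-1}\subset W^n$ is the set of points with last coordinate $w_0$. Let $n>1$, write $P=P_{n-1}$, $Q=\Sigma P\vee\hat{\mathfrak F}_{n-1}$, and let $q:\hat{\mathfrak F}_n\to\Sigma P$ and $p:\hat{\mathfrak F}_n\to\hat{\mathfrak F}_{n-1}$ be the suspensions of the pinch map $W^{n-1}\sqcup *\to P$ and of the projection $W^{n-1}\sqcup *\to W^{n-2}\sqcup *$ that forgets the last coordinate. (1) The map $e:\hat{\mathfrak F}_n\to Q$ that represents $(a,b)\mapsto p^*(b)\,q^*(a)$, $[\Sigma P,X]\times[\hat{\mathfrak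 F}_{n-1},X]\to\tau_{W^{n-1}}(X)$ (explicitly, $e$ is $\sigma_{W^{n-1}\sqcup *}$ followed by $p$ on the first summand and $q$ on the second), is a pointed homotopy equivalence $\hat{\mathfrak F}_n\simeq\Sigma P\vee\hat{\mathfrak F}_{n-1}$. (2) There is, up to pointed homotopy, exactly one map $\alpha:\Sigma P\to\hat{\mathfrak F}_{n-1}\vee\Sigma P$ with $q^*[\alpha]=p^*[\iota_1]^{-1}\,q^*[\iota_2]\,p^*[\iota_1]$ in $\tau_{W^{n-1}}(\hat{\mathfrak F}_{n-1}\vee\Sigma P)$, where $\iota_1,\iota_2$ are the inclusions of $\hat{\mathfrak F}_{n-1}$ and $\Sigma P$ (the co-action that represents the conjugation action of $[\hat{\mathfrak F}_{n-1},X]$ on $[\Sigma P,X]$). (3) Let $\nu_n:Q\to Q\vee Q$ be the map whose restriction to $\hat{\mathfrak F}_{n-1}$ is $$\hat{\mathfrak F}_{n-1}\xrightarrow{\nu_{n-1}}\hat{\mathfrak F}_{n-1}\vee\hat{\mathfrak F}_{n-1}\hookrightarrow Q\vee Q,$$ with $\nu_{n-1}$ the suspension co-multiplication, and whose restriction to $\Sigma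 P$ is $$\Sigma P\xrightarrow{\nu}\Sigma P\vee\Sigma P\xrightarrow{\alpha\vee 1}\hat{\mathfrak F}_{n-1}\vee\Sigma P\vee\Sigma P\hookrightarrow Q\vee Q,$$ with $\nu$ the suspension co-multiplication, where the last inclusion takes the two copies of $\Sigma P$ to the first and the second copy of $Q$, in this order, and $\hat{\mathfrak F}_{n-1}$ to the second copy of $Q$. Then $\nu_n$ is a co-multiplication on $Q$ (the constant map is a two-sided homotopy co-unit), $\nu_n\circ e\simeq(e\vee e)\circ\sigma_{W^{n-1}\sqcup *}$, and $\nu_n$ is, up to pointed homotopy, the only map $\mu:Q\to Q\vee Q$ that corresponds to the group structure on $\tau_{W^{n-1}}$, that is, with $e^*[(f,g)\circ\mu]=e^*[f]\,e^*[g]$ in $\tau_{W^{n-1}}(X)$ for all pointed spaces $X$ and all $f,g:Q\to X$. -/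

import Mathlib

open scoped unitInterval

namespace FoxSpace

universe u v w x

noncomputable section

/-! ### Pointed spaces, pointed maps and pointed homotopy -/

/-- A pointed topological space. -/
structure PSpace : Type (u + 1) where
  /-- the underlying space -/
  carrier : Type u
  [top : TopologicalSpace carrier]
  /-- the base point -/
  pt : carrier

instance : CoeSort PSpace.{u} (Type u) := ⟨PSpace.carrier⟩

instance (X : PSpace.{u}) : TopologicalSpace X := X.top

/-- A base point preserving continuous map. -/
@[ext]
structure PMap (X : PSpace.{u}) (Y : PSpace.{v}) where
  /-- the underlying continuous map -/
  toMap : C(X, Y)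
  map_pt : toMap X.pt = Y.pt

namespace PMap

variable {X : PSpace.{u}} {Y : PSpace.{v}} {Z : PSpace.{w}}

/-- The identity. -/
def id (X : PSpace.{u}) : PMap X X := ⟨ContinuousMap.id X, rfl⟩

/-- The constant map at the base point. -/
def const (X : PSpace.{u}) (Y : PSpace.{v}) : PMap X Y := ⟨ContinuousMap.const X Y.pt, rfl⟩

/-- Composition `g ∘ f`. -/
def comp (g : PMap Y Z) (f : PMap X Y) : PMap X Z :=
  ⟨g.toMap.comp f.toMap, by
    rw [ContinuousMap.comp_apply, f.map_pt, g.map_pt]⟩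

/-- Base point preserving homotopy. -/
def Homotopic (f g : PMap X Y) : Prop := f.toMap.HomotopicRel g.toMap {X.pt}

theorem Homotopic.comp {g g' : PMap Y Z} {f f' : PMap X Y} (hg : g.Homotopic g')
    (hf : f.Homotopic f') : (g.comp f).Homotopic (g'.comp f') := by
  obtain ⟨G⟩ := hg
  obtain ⟨F⟩ := hf
  refine ⟨⟨⟨⟨fun p => G (p.1, F p), by fun_prop⟩, ?_, ?_⟩, ?_⟩⟩
  · intro a
    simp [PMap.comp]
  · intro a
    simp [PMap.comp]
  · intro t a ha
    obtain rfl : a = X.pt := ha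
    have h1 : F (t, X.pt) = f.toMap X.pt := F.eq_fst t rfl
    have h2 : G (t, Y.pt) = g.toMap Y.pt := G.eq_fst t rfl
    simp [PMap.comp, h1, f.map_pt, h2]

/-- Base point preserving homotopy as an equivalence relation. -/
instance homotopySetoid (X : PSpace.{u}) (Y : PSpace.{v}) : Setoid (PMap X Y) where
  r := Homotopic
  iseqv :=
    ⟨fun f => ContinuousMap.HomotopicRel.refl f.toMap, fun h => ContinuousMap.HomotopicRel.symm h,
      fun h h' => ContinuousMap.HomotopicRel.trans h h'⟩

/-- A pointed map is a pointed homotopy equivalence. -/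
def IsHomotopyEquiv (f : PMap X Y) : Prop :=
  ∃ g : PMap Y X, (g.comp f).Homotopic (id X) ∧ (f.comp g).Homotopic (id Y)

end PMap

/-- The set `[X, Y]` of pointed homotopy classes of pointed maps. -/
def HClass (X : PSpace.{u}) (Y : PSpace.{v}) := Quotient (PMap.homotopySetoid X Y)

/-- The pointed homotopy class of a pointed map. -/
def HClass.mk {X : PSpace.{u}} {Y : PSpace.{v}} (f : PMap X Y) : HClass X Y :=
  Quotient.mk (PMap.homotopySetoid X Y) f

/-! ### Quotients that collapse a subset to a point -/

/-- The equivalence relation that identifies all points of `A`. -/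
def collapseSetoid {X : Type u} (A : Set X) : Setoid X where
  r x y := x = y ∨ (x ∈ A ∧ y ∈ A)
  iseqv := by
    refine ⟨fun x => Or.inl rfl, ?_, ?_⟩
    · rintro x y (rfl | h)
      · exact Or.inl rfl
      · exact Or.inr h.symm
    · rintro x y z (rfl | h) (rfl | h')
      · exact Or.inl rfl
      · exact Or.inr h'
      · exact Or.inr h
      · exact Or.inr ⟨h.1, h'.2⟩

/-- The quotient space `X / A`. -/
def Collapse {X : Type u} (A : Set X) : Type u := Quotient (collapseSetoid A)

namespace Collapse

variable {X : Type u} [TopologicalSpace X] {A : Set X}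

instance (A : Set X) : TopologicalSpace (Collapse A) :=
  inferInstanceAs (TopologicalSpace (Quotient (collapseSetoid A)))

/-- The quotient map `X → X / A`. -/
def mk (A : Set X) : C(X, Collapse A) :=
  ⟨Quotient.mk (collapseSetoid A), continuous_quotient_mk'⟩

theorem isQuotientMap_mk (A : Set X) : Topology.IsQuotientMap (mk A) := isQuotientMap_quotient_mk'

theorem mk_eq {a b : X} (ha : a ∈ A) (hb : b ∈ A) : mk A a = mk A b :=
  Quotient.sound (s := collapseSetoid A) (Or.inr ⟨ha, hb⟩)

/-- The map on `X / A` induced by a map that is constant on `A`. -/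
def lift {Y : Type v} [TopologicalSpace Y] (f : C(X, Y)) (h : ∀ a ∈ A, ∀ b ∈ A, f a = f b) :
    C(Collapse A, Y) :=
  ⟨Quotient.lift (s := collapseSetoid A) f (by
      rintro a b (rfl | hab)
      · rfl
      · exact h a hab.1 b hab.2),
    f.continuous.quotient_lift _⟩

@[simp]
theorem lift_mk {Y : Type v} [TopologicalSpace Y] (f : C(X, Y))
    (h : ∀ a ∈ A, ∀ b ∈ A, f a = f b) (a : X) : lift f h (mk A a) = f a := rfl

end Collapse

/-! ### Wedges -/

/-- The wedge `X ∨ Y`. -/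
def Wedge (X : PSpace.{u}) (Y : PSpace.{v}) : PSpace.{max u v} where
  carrier := Collapse ({Sum.inl X.pt, Sum.inr Y.pt} : Set (X ⊕ Y))
  pt := Collapse.mk _ (Sum.inl X.pt)

namespace Wedge

variable {X : PSpace.{u}} {Y : PSpace.{v}} {Z : PSpace.{w}} {T : PSpace.{x}}

/-- The inclusion of the first summand. -/
def inl (X : PSpace.{u}) (Y : PSpace.{v}) : PMap X (Wedge X Y) :=
  ⟨(Collapse.mk _).comp ⟨Sum.inl, continuous_inl⟩, rfl⟩

/-- The inclusion of the second summand. -/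
def inr (X : PSpace.{u}) (Y : PSpace.{v}) : PMap Y (Wedge X Y) :=
  ⟨(Collapse.mk _).comp ⟨Sum.inr, continuous_inr⟩, Collapse.mk_eq (by simp) (by simp)⟩

/-- The map `X ∨ Y → Z` that is `f` on `X` and `g` on `Y`. -/
def desc (f : PMap X Z) (g : PMap Y Z) : PMap (Wedge X Y) Z :=
  ⟨Collapse.lift ⟨Sum.elim f.toMap g.toMap, by fun_prop⟩ (by
      rintro a (rfl | rfl) b (rfl | rfl) <;> simp [f.map_pt, g.map_pt]), f.map_pt⟩

/-- The wedge `f ∨ g` of two maps. -/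
def map {X' : PSpace.{u}} {Y' : PSpace.{v}} (f : PMap X X') (g : PMap Y Y') :
    PMap (Wedge X Y) (Wedge X' Y') :=
  desc ((inl X' Y').comp f) ((inr X' Y').comp g)

theorem desc_homotopic {f f' : PMap X Z} {g g' : PMap Y Z} (hf : f.Homotopic f')
    (hg : g.Homotopic g') : (desc f g).Homotopic (desc f' g') := by
  obtain ⟨F⟩ := hf
  obtain ⟨G⟩ := hg
  have hF : ∀ t, F (t, X.pt) = Z.pt := fun t => (F.eq_fst t rfl).trans f.map_pt
  have hG : ∀ t, G (t, Y.pt) = Z.pt := fun t => (G.eq_fst t rfl).trans g.map_pt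
  let S : Set (X ⊕ Y) := {Sum.inl X.pt, Sum.inr Y.pt}
  let K : I × Collapse S → Z := fun q =>
    Quotient.lift (s := collapseSetoid S)
      (fun p => Sum.elim (fun a => F (q.1, a)) (fun b => G (q.1, b)) p) (by
        rintro p p' (rfl | ⟨rfl | rfl, rfl | rfl⟩) <;> simp [hF, hG]) q.2
  have hK : Continuous K := by
    refine (Collapse.isQuotientMap_mk S).continuous_lift_prod_right (Y := I) (g := K) ?_
    have h1 : Continuous fun p : (X ⊕ Y) × I =>
        Sum.elim (fun a => F (p.2, a)) (fun b => G (p.2, b)) p.1 := by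
      refine Topology.IsQuotientMap.continuous_lift_prod_left (Y := I) (X₀ := X ⊕ Y) (f := _root_.id)
        Topology.IsQuotientMap.id ?_
      rw [← (Homeomorph.sumProdDistrib (X := X) (Y := Y) (Z := I)).symm.comp_continuous_iff']
      refine continuous_sum_dom.2 ⟨?_, ?_⟩
      · exact (by fun_prop : Continuous fun p : X × I => F (p.2, p.1))
      · exact (by fun_prop : Continuous fun p : Y × I => G (p.2, p.1))
    exact h1.comp continuous_swap
  refine ⟨⟨⟨⟨K, hK⟩, ?_, ?_⟩, ?_⟩⟩
  · intro p
    obtain ⟨p, rfl⟩ := (Collapse.isQuotientMap_mk S).surjective p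
    rcases p with a | b
    · exact F.apply_zero a
    · exact G.apply_zero b
  · intro p
    obtain ⟨p, rfl⟩ := (Collapse.isQuotientMap_mk S).surjective p
    rcases p with a | b
    · exact F.apply_one a
    · exact G.apply_one b
  · rintro t p rfl
    exact (hF t).trans f.map_pt.symm

end Wedge

/-! ### Reduced suspensions and the groups `[ΣA, X]` -/

/-- The subset of `A × [0,1]` that is collapsed in the reduced suspension. -/
def suspSet (A : PSpace.{u}) : Set (A × I) := {p | p.1 = A.pt ∨ p.2 = 0 ∨ p.2 = 1}

/-- The reduced suspension `ΣA`. -/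
def Susp (A : PSpace.{u}) : PSpace.{u} where
  carrier := Collapse (suspSet A)
  pt := Collapse.mk _ (A.pt, 0)

/-- The affine function `t ↦ c t + d`, cut off to `[0,1]`. -/
def clamp (c d : ℝ) : C(I, I) :=
  ⟨fun t => Set.projIcc 0 1 zero_le_one (c * (t : ℝ) + d), by fun_prop⟩

namespace Susp

variable {A : PSpace.{u}} {B : PSpace.{v}} {X : PSpace.{w}}

/-- The point `[a, t]` of `ΣA`. -/
def point (a : A) (t : I) : Susp A := Collapse.mk (suspSet A) (a, t)

theorem point_eq_pt {a : A} {t : I} (h : a = A.pt ∨ t = 0 ∨ t = 1) : point a t = (Susp A).pt :=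
  Collapse.mk_eq h (Or.inl rfl)

theorem continuous_point : Continuous fun p : A × I => point p.1 p.2 :=
  (Collapse.mk (suspSet A)).continuous

/-- The pointed map on `ΣA` given by a map on `A × [0,1]`. -/
def lift (f : C(A × I, X)) (h : ∀ a t, (a = A.pt ∨ t = 0 ∨ t = 1) → f (a, t) = X.pt) :
    PMap (Susp A) X :=
  ⟨Collapse.lift f fun p hp q hq => (h p.1 p.2 hp).trans (h q.1 q.2 hq).symm,
    h A.pt 0 (Or.inl rfl)⟩

/-- The suspension `Σf`. -/
def map (f : PMap A B) : PMap (Susp A) (Susp B) :=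
  lift ⟨fun p => point (f.toMap p.1) p.2,
      continuous_point.comp (by fun_prop : Continuous fun p : A × I => (f.toMap p.1, p.2))⟩ (by
    rintro a t (rfl | h)
    · exact point_eq_pt (Or.inl f.map_pt)
    · exact point_eq_pt (Or.inr h))

theorem clamp_of_le {c d : ℝ} {t : I} (h : c * (t : ℝ) + d ≤ 0) : clamp c d t = 0 :=
  Set.projIcc_of_le_left zero_le_one h

theorem clamp_of_ge {c d : ℝ} {t : I} (h : 1 ≤ c * (t : ℝ) + d) : clamp c d t = 1 :=
  Set.projIcc_of_right_le zero_le_one h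

/-- The suspension co-multiplication `ΣA → ΣA ∨ ΣA`: it sends `[a, t]` to the point `[a, 2t]` of
the first summand if `t ≤ 1/2`, and to the point `[a, 2t - 1]` of the second one if `t ≥ 1/2`. -/
def comul (A : PSpace.{u}) : PMap (Susp A) (Wedge (Susp A) (Susp A)) :=
  lift
    ⟨fun p => if (p.2 : ℝ) ≤ 1 / 2 then (Wedge.inl (Susp A) (Susp A)).toMap (point p.1 (clamp 2 0 p.2))
        else (Wedge.inr (Susp A) (Susp A)).toMap (point p.1 (clamp 2 (-1) p.2)), by
      refine Continuous.if_le ?_ ?_ (by fun_prop) continuous_const ?_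
      · exact (Wedge.inl (Susp A) (Susp A)).toMap.continuous.comp (continuous_point.comp
          (by fun_prop : Continuous fun p : A × I => (p.1, clamp 2 0 p.2)))
      · exact (Wedge.inr (Susp A) (Susp A)).toMap.continuous.comp (continuous_point.comp
          (by fun_prop : Continuous fun p : A × I => (p.1, clamp 2 (-1) p.2)))
      · intro p hp
        rw [clamp_of_ge (by rw [hp]; norm_num), clamp_of_le (by rw [hp]; norm_num),
          point_eq_pt (Or.inr (Or.inr rfl)), point_eq_pt (Or.inr (Or.inl rfl)), PMap.map_pt,
          PMap.map_pt]⟩ (by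
    rintro a t h
    have h1 : (Wedge.inl (Susp A) (Susp A)).toMap (Susp A).pt = (Wedge (Susp A) (Susp A)).pt :=
      PMap.map_pt _
    have h2 : (Wedge.inr (Susp A) (Susp A)).toMap (Susp A).pt = (Wedge (Susp A) (Susp A)).pt :=
      PMap.map_pt _
    rcases h with rfl | rfl | rfl
    · simp [point_eq_pt (Or.inl rfl), h1, h2]
    · simp [clamp_of_le, point_eq_pt, h1]
    · have h3 : ¬ ((1 : ℝ) ≤ 2⁻¹) := by norm_num
      have h4 : clamp 2 (-1) 1 = 1 := clamp_of_ge (by norm_num)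
      simp [h3, h4, point_eq_pt, h2])

/-- The map `[a, t] ↦ [a, φ t]`, for a self map `φ` of `[0,1]` that preserves `{0, 1}`. -/
def reparam (A : PSpace.{u}) (φ : C(I, I)) (h0 : φ 0 = 0 ∨ φ 0 = 1) (h1 : φ 1 = 0 ∨ φ 1 = 1) :
    PMap (Susp A) (Susp A) :=
  lift ⟨fun p => point p.1 (φ p.2),
      continuous_point.comp (by fun_prop : Continuous fun p : A × I => (p.1, φ p.2))⟩ (by
    rintro a t (rfl | rfl | rfl)
    · exact point_eq_pt (Or.inl rfl)
    · exact point_eq_pt (Or.inr h0)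
    · exact point_eq_pt (Or.inr h1))

/-- The co-inverse `[a, t] ↦ [a, 1 - t]` of `ΣA`. -/
def rev (A : PSpace.{u}) : PMap (Susp A) (Susp A) :=
  reparam A ⟨unitInterval.symm, unitInterval.continuous_symm⟩ (by simp) (by simp)

/-- Two maps on `ΣA` agree if they agree on all points `[a, t]`. -/
theorem hom_ext {f g : PMap (Susp A) X} (h : ∀ a t, f.toMap (point a t) = g.toMap (point a t)) :
    f = g := by
  ext p
  obtain ⟨⟨a, t⟩, rfl⟩ := (Collapse.isQuotientMap_mk (suspSet A)).surjective p
  exact h a t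

theorem reparam_homotopic {φ ψ : C(I, I)} (h0 : φ 0 = 0 ∨ φ 0 = 1) (h1 : φ 1 = 0 ∨ φ 1 = 1)
    (h0' : ψ 0 = φ 0) (h1' : ψ 1 = φ 1) :
    (reparam A φ h0 h1).Homotopic
      (reparam A ψ (by rwa [h0']) (by rwa [h1'])) := by
  let θ : C(I × I, I) := ⟨fun q => Set.projIcc 0 1 zero_le_one
    ((1 - (q.1 : ℝ)) * (φ q.2 : ℝ) + (q.1 : ℝ) * (ψ q.2 : ℝ)), by fun_prop⟩
  have θ0 : ∀ t, θ (0, t) = φ t := by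
    intro t
    simp [θ]
  have θ1 : ∀ t, θ (1, t) = ψ t := by
    intro t
    simp [θ]
  have θe : ∀ s t, ψ t = φ t → θ (s, t) = φ t := by
    intro s t h
    have : (1 - (s : ℝ)) * (φ t : ℝ) + (s : ℝ) * (φ t : ℝ) = (φ t : ℝ) := by ring
    simp [θ, h, this]
  let F : (I × (A × I)) → Susp A := fun q => point q.2.1 (θ (q.1, q.2.2))
  have hF : Continuous F := continuous_point.comp
    (by fun_prop : Continuous fun q : I × (A × I) => (q.2.1, θ (q.1, q.2.2)))
  have key : ∀ s a t, (a = A.pt ∨ t = 0 ∨ t = 1) → F (s, (a, t)) = (Susp A).pt := by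
    rintro s a t (rfl | rfl | rfl)
    · exact point_eq_pt (Or.inl rfl)
    · exact point_eq_pt (Or.inr (by rw [θe s 0 h0']; exact h0))
    · exact point_eq_pt (Or.inr (by rw [θe s 1 h1']; exact h1))
  let G : I × Susp A → Susp A := fun q =>
    Quotient.lift (s := collapseSetoid (suspSet A)) (fun p => F (q.1, p)) (by
      rintro p p' (rfl | ⟨hp, hp'⟩)
      · rfl
      · exact (key q.1 p.1 p.2 hp).trans (key q.1 p'.1 p'.2 hp').symm) q.2
  have hG : Continuous G :=
    (Collapse.isQuotientMap_mk (suspSet A)).continuous_lift_prod_right (Y := I) (g := G) hF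
  refine ⟨⟨⟨⟨G, hG⟩, ?_, ?_⟩, ?_⟩⟩
  · intro p
    obtain ⟨⟨a, t⟩, rfl⟩ := (Collapse.isQuotientMap_mk (suspSet A)).surjective p
    change point a (θ (0, t)) = point a (φ t)
    rw [θ0]
  · intro p
    obtain ⟨⟨a, t⟩, rfl⟩ := (Collapse.isQuotientMap_mk (suspSet A)).surjective p
    change point a (θ (1, t)) = point a (ψ t)
    rw [θ1]
  · rintro s p rfl
    change F (s, (A.pt, 0)) = point A.pt (φ 0)
    rw [key s A.pt 0 (Or.inl rfl), point_eq_pt (Or.inl rfl)]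

/-- The product `(f, g) ∘ comul` of two maps on `ΣA`. -/
def mul (f g : PMap (Susp A) X) : PMap (Susp A) X := (Wedge.desc f g).comp (comul A)

theorem mul_point (f g : PMap (Susp A) X) (a : A) (t : I) :
    (mul f g).toMap (point a t) = if (t : ℝ) ≤ 1 / 2 then f.toMap (point a (clamp 2 0 t))
      else g.toMap (point a (clamp 2 (-1) t)) := by
  change (Wedge.desc f g).toMap (if (t : ℝ) ≤ 1 / 2 then _ else _) = _
  split_ifs <;> rfl

theorem reparam_point (φ : C(I, I)) (h0 : φ 0 = 0 ∨ φ 0 = 1) (h1 : φ 1 = 0 ∨ φ 1 = 1) (a : A)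
    (t : I) : (reparam A φ h0 h1).toMap (point a t) = point a (φ t) := rfl

theorem const_point (a : A) (t : I) : (PMap.const (Susp A) X).toMap (point a t) = X.pt := rfl

theorem apply_pt (f : PMap (Susp A) X) {a : A} {t : I} (h : t = 0 ∨ t = 1) :
    f.toMap (point a t) = X.pt := by
  rw [point_eq_pt (Or.inr h), f.map_pt]

theorem mul_homotopic {f f' g g' : PMap (Susp A) X} (hf : f.Homotopic f') (hg : g.Homotopic g') :
    (mul f g).Homotopic (mul f' g') :=
  (Wedge.desc_homotopic hf hg).comp (ContinuousMap.HomotopicRel.refl _)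

theorem id_eq_reparam : PMap.id (Susp A) = reparam A (ContinuousMap.id I) (by simp) (by simp) :=
  hom_ext fun _ _ => rfl

theorem comp_reparam_homotopic (f : PMap (Susp A) X) {φ : C(I, I)} (h0 : φ 0 = 0) (h1 : φ 1 = 1) :
    (f.comp (reparam A φ (Or.inl h0) (Or.inr h1))).Homotopic f := by
  have h := reparam_homotopic (A := A) (φ := φ) (ψ := ContinuousMap.id I) (Or.inl h0) (Or.inr h1)
    (by simp [h0]) (by simp [h1])
  rw [← id_eq_reparam] at h
  exact PMap.Homotopic.comp (ContinuousMap.HomotopicRel.refl f.toMap) h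

theorem coe_clamp {c d : ℝ} {t : I} (h0 : 0 ≤ c * (t : ℝ) + d) (h1 : c * (t : ℝ) + d ≤ 1) :
    (clamp c d t : ℝ) = c * (t : ℝ) + d := by
  change ((Set.projIcc (0 : ℝ) 1 zero_le_one (c * (t : ℝ) + d) : I) : ℝ) = _
  rw [Set.projIcc_of_mem zero_le_one ⟨h0, h1⟩]

theorem coe_clamp_eq {c d s : ℝ} {t : I} (hs : (t : ℝ) = s) (h0 : 0 ≤ c * s + d)
    (h1 : c * s + d ≤ 1) : (clamp c d t : ℝ) = c * s + d := by
  subst hs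
  exact coe_clamp h0 h1

theorem one_mul_homotopic (f : PMap (Susp A) X) :
    (mul (PMap.const (Susp A) X) f).Homotopic f := by
  have h := comp_reparam_homotopic f (φ := clamp 2 (-1)) (clamp_of_le (by norm_num))
    (clamp_of_ge (by norm_num))
  convert h using 1
  refine hom_ext fun a t => ?_
  rw [mul_point]
  change _ = f.toMap (point a (clamp 2 (-1) t))
  split_ifs with ht
  · rw [clamp_of_le (c := 2) (d := -1) (by linarith), apply_pt f (Or.inl rfl), const_point]
  · rfl

theorem rev_mul_homotopic (f : PMap (Susp A) X) :
    (mul (f.comp (rev A)) f).Homotopic (PMap.const (Susp A) X) := by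
  let φ : C(I, I) := ⟨fun t => Set.projIcc 0 1 zero_le_one |2 * (t : ℝ) - 1|, by fun_prop⟩
  have hφ : ∀ t : I, (φ t : ℝ) = |2 * (t : ℝ) - 1| := by
    intro t
    change ((Set.projIcc (0 : ℝ) 1 zero_le_one _ : I) : ℝ) = _
    rw [Set.projIcc_of_mem zero_le_one ⟨abs_nonneg _, ?_⟩]
    rw [abs_le]
    constructor <;> linarith [t.2.1, t.2.2]
  have h0 : φ 0 = 1 := by
    apply Subtype.ext
    rw [hφ]
    norm_num
  have h1 : φ 1 = 1 := by
    apply Subtype.ext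
    rw [hφ]
    norm_num
  have h := reparam_homotopic (A := A) (φ := φ) (ψ := ContinuousMap.const I 1) (Or.inr h0)
    (Or.inr h1) (by simp [h0]) (by simp [h1])
  have h' := PMap.Homotopic.comp (ContinuousMap.HomotopicRel.refl f.toMap : f.Homotopic f) h
  convert h' using 1
  · refine hom_ext fun a t => ?_
    rw [mul_point]
    change _ = f.toMap (point a (φ t))
    split_ifs with ht
    · change f.toMap (point a (unitInterval.symm (clamp 2 0 t))) = _
      congr 2
      apply Subtype.ext
      rw [hφ, unitInterval.coe_symm_eq, coe_clamp (by linarith [t.2.1]) (by linarith),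
        abs_of_nonpos (by linarith)]
      ring
    · congr 2
      apply Subtype.ext
      push Not at ht
      rw [hφ, coe_clamp (by linarith) (by linarith [t.2.2]), abs_of_nonneg (by linarith)]
      ring
  · refine hom_ext fun a t => ?_
    change _ = f.toMap (point a 1)
    rw [const_point, apply_pt f (Or.inr rfl)]

theorem mul_assoc_homotopic (f g h : PMap (Susp A) X) :
    (mul (mul f g) h).Homotopic (mul f (mul g h)) := by
  let φ : C(I, I) := ⟨fun t => Set.projIcc 0 1 zero_le_one
    (min (min (2 * (t : ℝ)) (t + 1 / 4)) ((t + 1) / 2)), by fun_prop⟩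
  have hφ : ∀ t : I, (φ t : ℝ) = min (min (2 * (t : ℝ)) (t + 1 / 4)) ((t + 1) / 2) := by
    intro t
    change ((Set.projIcc (0 : ℝ) 1 zero_le_one _ : I) : ℝ) = _
    rw [Set.projIcc_of_mem zero_le_one ⟨?_, ?_⟩]
    · have := t.2.1
      refine le_min (le_min ?_ ?_) ?_ <;> linarith
    · exact (min_le_right _ _).trans (by linarith [t.2.2])
  have hφ1 : ∀ t : I, (t : ℝ) ≤ 1 / 4 → (φ t : ℝ) = 2 * t := by
    intro t ht
    rw [hφ, min_eq_left (by linarith : 2 * (t : ℝ) ≤ t + 1 / 4), min_eq_left (by linarith)]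
  have hφ2 : ∀ t : I, 1 / 4 ≤ (t : ℝ) → (t : ℝ) ≤ 1 / 2 → (φ t : ℝ) = t + 1 / 4 := by
    intro t ht ht'
    rw [hφ, min_eq_right (by linarith : (t : ℝ) + 1 / 4 ≤ 2 * t), min_eq_left (by linarith)]
  have hφ3 : ∀ t : I, 1 / 2 ≤ (t : ℝ) → (φ t : ℝ) = (t + 1) / 2 := by
    intro t ht
    rw [hφ, min_eq_right (by linarith : (t : ℝ) + 1 / 4 ≤ 2 * t), min_eq_right (by linarith)]
  have h0 : φ 0 = 0 := by
    apply Subtype.ext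
    rw [hφ1 0 (by norm_num)]
    norm_num
  have h1 : φ 1 = 1 := by
    apply Subtype.ext
    rw [hφ3 1 (by norm_num)]
    norm_num
  have H := comp_reparam_homotopic (mul f (mul g h)) h0 h1
  convert H using 1
  refine hom_ext fun a t => ?_
  change _ = (mul f (mul g h)).toMap (point a (φ t))
  have hb := t.2
  rw [mul_point, mul_point f (mul g h)]
  by_cases ht : (t : ℝ) ≤ 1 / 2
  · have hc : (clamp 2 0 t : ℝ) = 2 * t + 0 := coe_clamp (by linarith [hb.1]) (by linarith)
    rw [if_pos ht, mul_point]
    by_cases ht' : (t : ℝ) ≤ 1 / 4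
    · have e := hφ1 t ht'
      rw [if_pos (by rw [hc]; linarith), if_pos (by rw [e]; linarith)]
      congr 2
      apply Subtype.ext
      refine (coe_clamp_eq hc (by linarith [hb.1]) (by linarith)).trans
        (Eq.trans ?_ (coe_clamp_eq e (by linarith [hb.1]) (by linarith)).symm)
      ring
    · push Not at ht'
      have e := hφ2 t ht'.le ht
      have e' : (clamp 2 (-1) (φ t) : ℝ) = 2 * (t + 1 / 4) + -1 :=
        coe_clamp_eq e (by linarith) (by linarith)
      rw [if_neg (by rw [hc]; linarith), if_neg (by rw [e]; linarith), mul_point,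
        if_pos (by rw [e']; linarith)]
      congr 2
      apply Subtype.ext
      refine (coe_clamp_eq hc (by linarith) (by linarith)).trans
        (Eq.trans ?_ (coe_clamp_eq e' (by linarith) (by linarith)).symm)
      ring
  · push Not at ht
    have e := hφ3 t ht.le
    have e' : (clamp 2 (-1) (φ t) : ℝ) = 2 * ((t + 1) / 2) + -1 :=
      coe_clamp_eq e (by linarith) (by linarith [hb.2])
    rw [if_neg (by linarith), if_neg (by rw [e]; linarith), mul_point,
      if_neg (by rw [e']; linarith)]
    congr 2
    apply Subtype.ext
    refine (coe_clamp (by linarith) (by linarith [hb.2])).trans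
      (Eq.trans ?_ (coe_clamp_eq e' (by linarith) (by linarith [hb.2])).symm)
    ring

/-- The group `[ΣA, X]`: the product of `[f]` and `[g]` is the class of `(f, g) ∘ comul`, the map
that runs through `f` and then through `g`. -/
instance (A : PSpace.{u}) (X : PSpace.{v}) : Group (HClass (Susp A) X) :=
  letI : Mul (HClass (Susp A) X) :=
    ⟨Quotient.map₂ mul fun _ _ hf _ _ hg => mul_homotopic hf hg⟩
  letI : One (HClass (Susp A) X) := ⟨HClass.mk (PMap.const (Susp A) X)⟩
  letI : Inv (HClass (Susp A) X) :=
    ⟨Quotient.map (fun f => f.comp (rev A)) fun _ _ hf =>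
      PMap.Homotopic.comp hf (ContinuousMap.HomotopicRel.refl _)⟩
  Group.ofLeftAxioms
    (by
      rintro ⟨f⟩ ⟨g⟩ ⟨h⟩
      exact Quotient.sound (mul_assoc_homotopic f g h))
    (by
      rintro ⟨f⟩
      exact Quotient.sound (one_mul_homotopic f))
    (by
      rintro ⟨f⟩
      exact Quotient.sound (rev_mul_homotopic f))

theorem mk_mul (f g : PMap (Susp A) X) :
    HClass.mk f * HClass.mk g = HClass.mk ((Wedge.desc f g).comp (comul A)) := rfl

theorem mk_inv (f : PMap (Susp A) X) : (HClass.mk f)⁻¹ = HClass.mk (f.comp (rev A)) := rfl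

end Susp

/-! ### Well-pointed spaces -/

/-- The space `W` is well-pointed at `w₀`: the inclusion of `w₀` is a cofibration, that is, it has
the homotopy extension property with respect to all spaces. -/
def WellPointed (W : Type u) [TopologicalSpace W] (w₀ : W) : Prop :=
  ∀ (Y : Type u) [TopologicalSpace Y] (f : C(W, Y)) (γ : C(I, Y)), γ 0 = f w₀ →
    ∃ H : C(W × I, Y), (∀ a, H (a, 0) = f a) ∧ ∀ t, H (w₀, t) = γ t

/-! ### Fox spaces, pinched spaces and the co-multiplication -/

/-- `Y ⊔ *`, the space `Y` with a disjoint base point. -/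
def Plus (Y : Type u) [TopologicalSpace Y] : PSpace.{u} where
  carrier := Y ⊕ Unit
  pt := Sum.inr ()

section Fox

variable (W : Type u) [TopologicalSpace W] (w₀ : W)

/-- The space `F̂_n(W) = Σ(W^(n-1) ⊔ *)`, for `n ≥ 1`. -/
def Fox (n : ℕ) : PSpace.{u} := Susp (Plus (Fin (n - 1) → W))

/-- The `W^(n-1)`-Fox group `τ_{W^(n-1)}(X) = [Σ(W^(n-1) ⊔ *), X]`, with the group structure of the
homotopy classes of maps on a suspension. -/
abbrev FoxGroup (n : ℕ) (X : PSpace.{v}) : Type (max u v) :=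
  HClass (Susp (Plus (Fin (n - 1) → W))) X

/-- The subspace `W^(k-1) = {x | x_k = w₀}` of `W^k`, for `k ≥ 1`. -/
def lastAtBase (k : ℕ) : Set (Fin k → W) := {x | ∀ i : Fin k, i.val + 1 = k → x i = w₀}

/-- The `k`-fold pinched space `P_k(W) = W^k / W^(k-1)`, for `k ≥ 1`. -/
def Pinched (k : ℕ) : PSpace.{u} where
  carrier := Collapse (lastAtBase W w₀ k)
  pt := Collapse.mk _ fun _ => w₀

/-- The pinch map `W^k ⊔ * → P_k(W)`. -/
def pinch (k : ℕ) : PMap (Plus (Fin k → W)) (Pinched W w₀ k) :=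
  ⟨⟨Sum.elim (Collapse.mk (lastAtBase W w₀ k)) fun _ => (Pinched W w₀ k).pt,
    (Collapse.mk (lastAtBase W w₀ k)).continuous.sumElim continuous_const⟩, rfl⟩

/-- The projection `W^k ⊔ * → W^(k-1) ⊔ *` that forgets the last coordinate, for `k ≥ 1`. -/
def proj (k : ℕ) : PMap (Plus (Fin k → W)) (Plus (Fin (k - 1) → W)) :=
  ⟨⟨Sum.map (fun x i => x (Fin.castLE (Nat.sub_le k 1) i)) _root_.id,
    Continuous.sumMap (by fun_prop) continuous_id⟩, rfl⟩

/-- `ΣP_(n-1)(W) ∨ F̂_(n-1)(W)`. -/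
abbrev FoxWedge (n : ℕ) : PSpace.{u} :=
  Wedge (Susp (Pinched W w₀ (n - 1))) (Fox W (n - 1))

/-- `Σq : F̂_n(W) → ΣP_(n-1)(W)`, the suspension of the pinch map. -/
def foxPinch (n : ℕ) : PMap (Fox W n) (Susp (Pinched W w₀ (n - 1))) :=
  Susp.map (pinch W w₀ (n - 1))

/-- `Σp : F̂_n(W) → F̂_(n-1)(W)`, the suspension of the projection. -/
def foxProj (n : ℕ) : PMap (Fox W n) (Fox W (n - 1)) :=
  Susp.map (proj W (n - 1))

/-- The map `F̂_n(W) → ΣP_(n-1)(W) ∨ F̂_(n-1)(W)` that represents the natural map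
`[ΣP_(n-1)(W), X] × [F̂_(n-1)(W), X] → [F̂_n(W), X]`, `(a, b) ↦ p^*(b) q^*(a)`: it runs through
`Σp` and then through `Σq`. -/
def foxSplit (n : ℕ) : PMap (Fox W n) (FoxWedge W w₀ n) :=
  (Wedge.desc
    ((Wedge.inr (Susp (Pinched W w₀ (n - 1))) (Fox W (n - 1))).comp (foxProj W n))
    ((Wedge.inl (Susp (Pinched W w₀ (n - 1))) (Fox W (n - 1))).comp (foxPinch W w₀ n))).comp
  (Susp.comul (Plus (Fin (n - 1) → W)))

/-- `α : ΣP_(n-1)(W) → F̂_(n-1)(W) ∨ ΣP_(n-1)(W)` is a co-action map: its class is the value at the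
two inclusions `(b, a)` of the action `a · b = b⁻¹ a b` of `[F̂_(n-1)(W), X]` on
`[ΣP_(n-1)(W), X]`, both seen in `τ_{W^(n-1)}(X)`, for `X = F̂_(n-1)(W) ∨ ΣP_(n-1)(W)`. -/
def IsCoaction (n : ℕ)
    (α : PMap (Susp (Pinched W w₀ (n - 1)))
      (Wedge (Fox W (n - 1)) (Susp (Pinched W w₀ (n - 1))))) : Prop :=
  let b : FoxGroup W n (Wedge (Fox W (n - 1)) (Susp (Pinched W w₀ (n - 1)))) :=
    HClass.mk ((Wedge.inl _ _).comp (foxProj W n))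
  let a : FoxGroup W n (Wedge (Fox W (n - 1)) (Susp (Pinched W w₀ (n - 1)))) :=
    HClass.mk ((Wedge.inr _ _).comp (foxPinch W w₀ n))
  HClass.mk (α.comp (foxPinch W w₀ n)) = b⁻¹ * a * b

/-- `ν¹ : F̂_(n-1) → F̂_(n-1) ∨ F̂_(n-1) ↪ Q ∨ Q`, where `Q = ΣP_(n-1) ∨ F̂_(n-1)` and the first map is
the suspension co-multiplication. -/
def foxComulOne (n : ℕ) :
    PMap (Fox W (n - 1)) (Wedge (FoxWedge W w₀ n) (FoxWedge W w₀ n)) :=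
  (Wedge.map (Wedge.inr (Susp (Pinched W w₀ (n - 1))) (Fox W (n - 1)))
    (Wedge.inr (Susp (Pinched W w₀ (n - 1))) (Fox W (n - 1)))).comp
  (Susp.comul (Plus (Fin (n - 1 - 1) → W)))

/-- The inclusion `(F̂_(n-1) ∨ ΣP_(n-1)) ∨ ΣP_(n-1) ↪ Q ∨ Q`, where `Q = ΣP_(n-1) ∨ F̂_(n-1)`: the two
copies of `ΣP_(n-1)` go, in this order, to the first and to the second copy of `Q`, and `F̂_(n-1)`
goes to the second copy of `Q`. -/
def foxIncl (n : ℕ) :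
    PMap (Wedge (Wedge (Fox W (n - 1)) (Susp (Pinched W w₀ (n - 1))))
        (Susp (Pinched W w₀ (n - 1))))
      (Wedge (FoxWedge W w₀ n) (FoxWedge W w₀ n)) :=
  Wedge.desc
    (Wedge.desc
      ((Wedge.inr (FoxWedge W w₀ n) (FoxWedge W w₀ n)).comp (Wedge.inr _ _))
      ((Wedge.inl (FoxWedge W w₀ n) (FoxWedge W w₀ n)).comp (Wedge.inl _ _)))
    ((Wedge.inr (FoxWedge W w₀ n) (FoxWedge W w₀ n)).comp (Wedge.inl _ _))

/-- `ν² : ΣP → ΣP ∨ ΣP → (F̂_(n-1) ∨ ΣP) ∨ ΣP ↪ Q ∨ Q`, where `P = P_(n-1)(W)`,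
`Q = ΣP ∨ F̂_(n-1)`, the first map is the suspension co-multiplication and the second is `α ∨ 1`. -/
def foxComulTwo (n : ℕ)
    (α : PMap (Susp (Pinched W w₀ (n - 1)))
      (Wedge (Fox W (n - 1)) (Susp (Pinched W w₀ (n - 1))))) :
    PMap (Susp (Pinched W w₀ (n - 1))) (Wedge (FoxWedge W w₀ n) (FoxWedge W w₀ n)) :=
  (foxIncl W w₀ n).comp
    ((Wedge.map α (PMap.id (Susp (Pinched W w₀ (n - 1))))).comp
      (Susp.comul (Pinched W w₀ (n - 1))))

/-- The map `ν_n : Q → Q ∨ Q` on `Q = ΣP_(n-1)(W) ∨ F̂_(n-1)(W)` that is `ν²` on the first summand and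
`ν¹` on the second one. -/
def foxComul (n : ℕ)
    (α : PMap (Susp (Pinched W w₀ (n - 1)))
      (Wedge (Fox W (n - 1)) (Susp (Pinched W w₀ (n - 1))))) :
    PMap (FoxWedge W w₀ n) (Wedge (FoxWedge W w₀ n) (FoxWedge W w₀ n)) :=
  Wedge.desc (foxComulTwo W w₀ n α) (foxComulOne W w₀ n)

end Fox

/-- A co-multiplication on `Q`: a map `Q → Q ∨ Q` for which the constant map is a two-sided co-unit
up to homotopy. -/
def IsComultiplication {Q : PSpace.{u}} (ν : PMap Q (Wedge Q Q)) : Prop :=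
  ((Wedge.desc (PMap.id Q) (PMap.const Q Q)).comp ν).Homotopic (PMap.id Q) ∧
    ((Wedge.desc (PMap.const Q Q) (PMap.id Q)).comp ν).Homotopic (PMap.id Q)

/-- Under `e : ΣA → Q`, the map `ν : Q → Q ∨ Q` corresponds to the group structure on `[ΣA, X]`, for
every pointed space `X`: the product `(f, g) ∘ ν` of two maps on `Q` goes to the product in
`[ΣA, X]`. -/
def InducesGroupStructure {A Q : PSpace.{u}} (e : PMap (Susp A) Q) (ν : PMap Q (Wedge Q Q)) :
    Prop :=
  ∀ (X : PSpace.{u}) (f g : PMap Q X),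
    HClass.mk (((Wedge.desc f g).comp ν).comp e) = HClass.mk (f.comp e) * HClass.mk (g.comp e)

end

end FoxSpace

namespace FoxSpace

universe u v w x

/-! ### Homotopy classes and composition -/

namespace HClass

variable {X : PSpace.{u}} {Y : PSpace.{v}} {Z : PSpace.{w}}

/-! Put k = n - 1, A = W^k ⊔ *, B = W^(k-1) ⊔ * and C = P_k, with the inclusion i : B → A at last
coordinate w₀, its retraction p : A → B and the pinch map q : A → C. The splitting rests on one map
γ : ΣC → ΣA. In [ΣA, ΣA] the class [Σ(i ∘ p)]⁻¹ [1] becomes trivial after restriction along Σi,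
because p ∘ i = 1. As w₀ → W is a cofibration, the null-homotopy extends over ΣA and the class
factors as γ ∘ Σq. The composite of the extended homotopy with Σq descends to ΣC and shows Σq ∘ γ ≃
1 (`WellPointed.exists_suspSplitting`).

All else is algebra in groups [ΣA, X]. The map (γ, Σi) is a homotopy inverse of e
(`SuspSplitting.isHomotopyEquiv`). The map q^* is injective, since Σq has the right homotopy inverse
γ, and its image is the kernel of i^*. Hence b⁻¹ a b, which i^* kills when a is in the image of q^*
and b in that of p^*, comes from exactly one class α on ΣP.

With a₁, a₂, b₁, b₂ the classes of the four summands of Q ∨ Q, pulled back to ΣA, one finds e^*[ν_n]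
= b₁ b₂ · (b₂⁻¹ a₁ b₂) a₂ = (b₁ a₁)(b₂ a₂) (`mk_foxComul_comp_foxSplit`). The right side is the
product of the two inclusions of Q, composed with e. This is the universal case of the group
structure. Since e can be cancelled, the co-unit laws and uniqueness follow. -/

theorem mk_eq_mk {f g : PMap X Y} : mk f = mk g ↔ f.Homotopic g :=
  ⟨fun h => Quotient.exact h, fun h => Quotient.sound h⟩

theorem mk_comp_congr {g g' : PMap Y Z} {f f' : PMap X Y} (hg : mk g = mk g')
    (hf : mk f = mk f') : mk (g.comp f) = mk (g'.comp f') :=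
  mk_eq_mk.2 ((mk_eq_mk.1 hg).comp (mk_eq_mk.1 hf))

theorem mk_comp_left (g : PMap Y Z) {f f' : PMap X Y} (hf : mk f = mk f') :
    mk (g.comp f) = mk (g.comp f') :=
  mk_comp_congr rfl hf

theorem mk_comp_right {g g' : PMap Y Z} (hg : mk g = mk g') (f : PMap X Y) :
    mk (g.comp f) = mk (g'.comp f) :=
  mk_comp_congr hg rfl

/-- A pointed homotopy equivalence can be cancelled on the right. -/
theorem mk_eq_of_comp_isHomotopyEquiv {e : PMap X Y} (he : e.IsHomotopyEquiv)
    {f f' : PMap Y Z} (h : mk (f.comp e) = mk (f'.comp e)) : mk f = mk f' := by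
  obtain ⟨g, -, hg⟩ := he
  have key : ∀ k : PMap Y Z, mk ((k.comp e).comp g) = mk k := fun k =>
    mk_comp_left k (mk_eq_mk.2 hg)
  rw [← key f, ← key f']
  exact mk_comp_right h g

end HClass

namespace PMap

variable {X : PSpace.{u}} {Y : PSpace.{v}}

theorem comp_const {Z : PSpace.{w}} (g : PMap Y Z) : g.comp (const X Y) = const X Z :=
  PMap.ext (ContinuousMap.ext fun _ => g.map_pt)

end PMap

namespace Wedge

variable {X : PSpace.{u}} {Y : PSpace.{v}} {Z : PSpace.{w}} {T : PSpace.{x}}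

theorem hom_ext {f g : PMap (Wedge X Y) Z} (hl : f.comp (inl X Y) = g.comp (inl X Y))
    (hr : f.comp (inr X Y) = g.comp (inr X Y)) : f = g := by
  ext p
  obtain ⟨p, rfl⟩ := (Collapse.isQuotientMap_mk _).surjective p
  rcases p with a | b
  · exact congrArg (fun k : PMap X Z => k.toMap a) hl
  · exact congrArg (fun k : PMap Y Z => k.toMap b) hr

theorem desc_inl_inr : desc (inl X Y) (inr X Y) = PMap.id (Wedge X Y) :=
  hom_ext rfl rfl

theorem comp_desc (h : PMap Z T) (f : PMap X Z) (g : PMap Y Z) :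
    h.comp (desc f g) = desc (h.comp f) (h.comp g) :=
  hom_ext rfl rfl

end Wedge

/-! ### Functoriality of the groups `[ΣA, X]` -/

namespace Susp

variable {A : PSpace.{u}} {B : PSpace.{v}} {X : PSpace.{w}} {Y : PSpace.{x}}

theorem comp_mul (h : PMap X Y) (f g : PMap (Susp A) X) :
    h.comp (mul f g) = mul (h.comp f) (h.comp g) :=
  congrArg (fun k => PMap.comp k (comul A)) (Wedge.comp_desc h f g)

theorem mul_comp_map (f g : PMap (Susp B) X) (k : PMap A B) :
    (mul f g).comp (map k) = mul (f.comp (map k)) (g.comp (map k)) := by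
  refine hom_ext fun a t => ?_
  rw [mul_point]
  exact mul_point f g (k.toMap a) t

/-- The homomorphism `[ΣA, X] → [ΣA, Y]` induced by `h : X → Y`. -/
noncomputable def push (A : PSpace.{u}) (h : PMap X Y) :
    HClass (Susp A) X →* HClass (Susp A) Y :=
  MonoidHom.mk' (Quotient.map h.comp fun _ _ hf =>
    PMap.Homotopic.comp (ContinuousMap.HomotopicRel.refl _) hf) (by
      rintro ⟨f⟩ ⟨g⟩
      exact congrArg HClass.mk (comp_mul h f g))

/-- The homomorphism `[ΣB, X] → [ΣA, X]` induced by `k : A → B`. -/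
noncomputable def pull (X : PSpace.{w}) (k : PMap A B) :
    HClass (Susp B) X →* HClass (Susp A) X :=
  MonoidHom.mk' (Quotient.map (fun f => f.comp (map k)) fun _ _ hf =>
    PMap.Homotopic.comp hf (ContinuousMap.HomotopicRel.refl _)) (by
      rintro ⟨f⟩ ⟨g⟩
      exact congrArg HClass.mk (mul_comp_map f g k))

theorem pull_mk (k : PMap A B) (f : PMap (Susp B) X) :
    pull X k (HClass.mk f) = HClass.mk (f.comp (map k)) := rfl

theorem mk_const : HClass.mk (PMap.const (Susp A) X) = 1 := rfl

theorem map_id : map (PMap.id A) = PMap.id (Susp A) := hom_ext fun _ _ => rfl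

theorem map_comp {C : PSpace.{w}} (g : PMap B C) (f : PMap A B) :
    (map g).comp (map f) = map (g.comp f) := hom_ext fun _ _ => rfl

theorem map_const : map (PMap.const A B) = PMap.const (Susp A) (Susp B) :=
  hom_ext fun _ _ => point_eq_pt (Or.inl rfl)

end Susp

/-! ### Split cofibre sequences after suspension -/

section Split

variable {A B C : PSpace.{u}}

/-- The map `ΣA → ΣC ∨ ΣB` that runs through `Σp` and then through `Σq`. -/
noncomputable def suspSplit (p : PMap A B) (q : PMap A C) :
    PMap (Susp A) (Wedge (Susp C) (Susp B)) :=
  (Wedge.desc ((Wedge.inr _ _).comp (Susp.map p)) ((Wedge.inl _ _).comp (Susp.map q))).comp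
    (Susp.comul A)

/-- Composition with h is a homomorphism, and `suspSplit` is itself the product of its two inclusion
terms. So evaluating a map on the splitting amounts to a product of pullbacks, with the p-factor on
the left. -/
theorem mk_comp_suspSplit {X : PSpace.{u}} (p : PMap A B) (q : PMap A C)
    (h : PMap (Wedge (Susp C) (Susp B)) X) :
    HClass.mk (h.comp (suspSplit p q)) =
      Susp.pull X p (HClass.mk (h.comp (Wedge.inr _ _))) *
        Susp.pull X q (HClass.mk (h.comp (Wedge.inl _ _))) :=
  map_mul (Susp.push A h) (HClass.mk ((Wedge.inr _ _).comp (Susp.map p)))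
    (HClass.mk ((Wedge.inl _ _).comp (Susp.map q)))

/-- The maps `B → A → C` with a retraction `p : A → B` split after suspension: `γ : ΣC → ΣA` is a
right inverse of `Σq` up to homotopy, and `γ ∘ Σq` is the class `[Σ(i ∘ p)]⁻¹ [1]`. -/
structure SuspSplitting (i : PMap B A) (p : PMap A B) (q : PMap A C)
    (γ : PMap (Susp C) (Susp A)) : Prop where
  proj_incl : p.comp i = PMap.id B
  pinch_incl : q.comp i = PMap.const B C
  comp_pinch : HClass.mk (γ.comp (Susp.map q)) =
    (HClass.mk (Susp.map (i.comp p)))⁻¹ * HClass.mk (PMap.id (Susp A))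
  pinch_comp : HClass.mk ((Susp.map q).comp γ) = HClass.mk (PMap.id (Susp C))

namespace SuspSplitting

variable {i : PMap B A} {p : PMap A B} {q : PMap A C} {γ : PMap (Susp C) (Susp A)}
  {X : PSpace.{u}}

/-- Injectivity of q^*: composing with γ undoes it, as Σq ∘ γ ≃ 1. -/
theorem mk_eq_of_comp_pinch (S : SuspSplitting i p q γ) {f f' : PMap (Susp C) X}
    (h : HClass.mk (f.comp (Susp.map q)) = HClass.mk (f'.comp (Susp.map q))) :
    HClass.mk f = HClass.mk f' := by
  have key : ∀ k : PMap (Susp C) X, HClass.mk ((k.comp (Susp.map q)).comp γ) = HClass.mk k :=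
    fun k => HClass.mk_comp_left k S.pinch_comp
  rw [← key f, ← key f']
  exact HClass.mk_comp_right h γ

/-- Pushing the defining relation of γ forward along c measures how far c is from factoring through
the pinch map: the correction is the part of c pulled back from B. -/
theorem mk_comp_comp_pinch (S : SuspSplitting i p q γ) (c : PMap (Susp A) X) :
    HClass.mk ((c.comp γ).comp (Susp.map q)) =
      (Susp.pull X p (Susp.pull X i (HClass.mk c)))⁻¹ * HClass.mk c := by
  have h := congrArg (Susp.push A c) S.comp_pinch
  rw [map_mul, map_inv] at h
  rw [← Susp.map_comp] at h
  exact h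

theorem pull_incl_pull_proj (S : SuspSplitting i p q γ) (b : HClass (Susp B) X) :
    Susp.pull X i (Susp.pull X p b) = b := by
  obtain ⟨b⟩ := b
  change HClass.mk (b.comp ((Susp.map p).comp (Susp.map i))) = HClass.mk b
  rw [Susp.map_comp, S.proj_incl, Susp.map_id]
  rfl

theorem pull_incl_pull_pinch (S : SuspSplitting i p q γ) (a : HClass (Susp C) X) :
    Susp.pull X i (Susp.pull X q a) = 1 := by
  obtain ⟨a⟩ := a
  change HClass.mk (a.comp ((Susp.map q).comp (Susp.map i))) = 1
  rw [Susp.map_comp, S.pinch_incl, Susp.map_const, PMap.comp_const, Susp.mk_const]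

/-- Exactness at [ΣA, X]: when i^* kills c, the correction factor in `mk_comp_comp_pinch` is
trivial, so c ∘ γ is a preimage under q^*. -/
theorem exists_comp_pinch (S : SuspSplitting i p q γ) (c : HClass (Susp A) X)
    (hc : Susp.pull X i c = 1) :
    ∃ a : PMap (Susp C) X, HClass.mk (a.comp (Susp.map q)) = c := by
  obtain ⟨c⟩ := c
  refine ⟨c.comp γ, (S.mk_comp_comp_pinch c).trans ?_⟩
  erw [hc]
  rw [map_one, inv_one, one_mul]
  rfl

theorem isHomotopyEquiv (S : SuspSplitting i p q γ) : (suspSplit p q).IsHomotopyEquiv := by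
  refine ⟨Wedge.desc γ (Susp.map i), ?_, ?_⟩
  -- The composite on ΣA is [Σ(i ∘ p)] · [Σ(i ∘ p)]⁻¹ [1].
  · rw [← HClass.mk_eq_mk, mk_comp_suspSplit]
    change HClass.mk ((Susp.map i).comp (Susp.map p)) * HClass.mk (γ.comp (Susp.map q)) = _
    rw [S.comp_pinch, Susp.map_comp, mul_inv_cancel_left]
  · have hi : HClass.mk ((suspSplit p q).comp (Susp.map i)) =
        HClass.mk (Wedge.inr (Susp C) (Susp B)) := by
      -- Here e is p^*[inr] · q^*[inl], and i^* p^* = 1 while i^* q^* is trivial, so only the second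
      -- summand survives.
      have h := congrArg (Susp.pull _ i) (mk_comp_suspSplit p q (PMap.id _))
      rw [map_mul, S.pull_incl_pull_proj, S.pull_incl_pull_pinch, mul_one] at h
      exact h
    have hγ : HClass.mk ((suspSplit p q).comp γ) = HClass.mk (Wedge.inl (Susp C) (Susp B)) := by
      -- After applying the injective q^*, the left side becomes (p^*[inr])⁻¹ · p^*[inr] · q^*[inl].
      refine S.mk_eq_of_comp_pinch ?_
      rw [S.mk_comp_comp_pinch, Susp.pull_mk i, hi]
      have h := mk_comp_suspSplit p q (PMap.id _)
      change HClass.mk (suspSplit p q) = _ at h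
      rw [h]
      exact inv_mul_cancel_left _ _
    rw [Wedge.comp_desc, ← Wedge.desc_inl_inr]
    exact Wedge.desc_homotopic (HClass.mk_eq_mk.1 hγ) (HClass.mk_eq_mk.1 hi)

end SuspSplitting

end Split

/-! ### Consequences of well-pointedness -/

/-- The continuous map on `B × E` that is given by a map on `B × (W ∨ [0,1])`, where `E → W ∨ [0,1]`
has the components `r` and `τ`. -/
theorem continuous_paste {B : Type u} {W : Type v} {Z : Type w} {E : Type x} [TopologicalSpace B]
    [TopologicalSpace W] [TopologicalSpace Z] [TopologicalSpace E] {w₀ : W} (f : C(B × W, Z))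
    (N : C(B × I, Z)) (hN : ∀ b, f (b, w₀) = N (b, 0)) (r : C(E, W)) (τ : C(E, I))
    (h : ∀ x, τ x = 0 ∨ r x = w₀) :
    Continuous fun y : B × E => if τ y.2 = 0 then f (y.1, r y.2) else N (y.1, τ y.2) := by
  rw [continuous_iff_continuousAt]
  rintro ⟨b, x⟩
  have cf : Continuous fun y : B × E => f (y.1, r y.2) := by fun_prop
  have cN : Continuous fun y : B × E => N (y.1, τ y.2) := by fun_prop
  by_cases hx : τ x = 0
  · intro V hV
    simp only [hx, if_true] at hV
    have h1 : ∀ᶠ y in nhds (b, x), f (y.1, r y.2) ∈ V := cf.continuousAt hV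
    -- The point w₀ need not be closed, so the pieces cannot be glued along closed sets. If V is
    -- also a neighbourhood of f (b, w₀) = N (b, 0), both branches stay in V near (b, x).
    by_cases hb : V ∈ nhds (f (b, w₀))
    · have h2 : ∀ᶠ y in nhds (b, x), N (y.1, τ y.2) ∈ V := by
        refine cN.continuousAt ?_
        simp only [hx, ← hN b]
        exact hb
      change ∀ᶠ y : B × E in nhds (b, x), (if τ y.2 = 0 then f (y.1, r y.2) else N (y.1, τ y.2)) ∈ V
      filter_upwards [h1, h2] with y hy1 hy2
      split_ifs
      exacts [hy1, hy2]
    -- Otherwise f (b, w₀) is outside the interior of V, while f (b, r x') is inside it for x' near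
    -- x. Hence r x' ≠ w₀ there, so τ x' = 0 and only the first branch occurs.
    · have c1 : Continuous fun x' : E => f (b, r x') := by fun_prop
      have h2 : ∀ᶠ x' in nhds x, f (b, r x') ∈ interior V :=
        c1.continuousAt (interior_mem_nhds.2 hV)
      have h3 : ∀ᶠ y : B × E in nhds (b, x), f (b, r y.2) ∈ interior V :=
        (continuous_snd (X := B) (Y := E)).continuousAt (x := (b, x)) |>.eventually h2
      change ∀ᶠ y : B × E in nhds (b, x), (if τ y.2 = 0 then f (y.1, r y.2) else N (y.1, τ y.2)) ∈ V
      filter_upwards [h1, h3] with y hy1 hy3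
      have : τ y.2 = 0 := by
        rcases h y.2 with h0 | h0
        · exact h0
        · rw [h0] at hy3
          exact absurd (mem_interior_iff_mem_nhds.1 hy3) hb
      rwa [if_pos this]
  · have h1 : ∀ᶠ y : B × E in nhds (b, x), τ y.2 ≠ 0 :=
      (by fun_prop : Continuous fun y : B × E => τ y.2).continuousAt.eventually_ne hx
    refine (cN.continuousAt (x := (b, x))).congr ?_
    filter_upwards [h1] with y hy
    rw [if_neg hy]

/-- The retraction of `W × [0,1]` to `W ∨ [0,1]`, by its components in `W` and `[0,1]`. -/
theorem WellPointed.exists_retraction {W : Type u} [TopologicalSpace W] {w₀ : W}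
    (hW : WellPointed W w₀) :
    ∃ (r : C(W × I, W)) (τ : C(W × I, I)), (∀ x, τ x = 0 ∨ r x = w₀) ∧
      (∀ a, r (a, 0) = a ∧ τ (a, 0) = 0) ∧ ∀ t, r (w₀, t) = w₀ ∧ τ (w₀, t) = t := by
  let W' : PSpace.{u} := ⟨W, w₀⟩
  let I' : PSpace.{0} := ⟨I, (0 : I)⟩
  -- The homotopy extension property is applied to the universal target W ∨ [0,1]. The components of
  -- H suffice later, whereas a map defined on B × (W ∨ [0,1]) by gluing could fail to be continuous
  -- for B not locally compact.
  obtain ⟨H, H0, H1⟩ := hW (Wedge W' I') (Wedge.inl W' I').toMap (Wedge.inr W' I').toMap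
    ((Wedge.inr W' I').map_pt.trans (Wedge.inl W' I').map_pt.symm)
  let rr : PMap (Wedge W' I') W' := Wedge.desc (PMap.id W') (PMap.const I' W')
  let tt : PMap (Wedge W' I') I' := Wedge.desc (PMap.const W' I') (PMap.id I')
  refine ⟨rr.toMap.comp H, tt.toMap.comp H, fun x => ?_, fun a => ⟨?_, ?_⟩, fun t => ⟨?_, ?_⟩⟩
  · change tt.toMap (H x) = (0 : I) ∨ rr.toMap (H x) = w₀
    obtain ⟨p, hp⟩ := (Collapse.isQuotientMap_mk _).surjective (H x)
    rw [← hp]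
    rcases p with a | b
    · exact Or.inl rfl
    · exact Or.inr rfl
  · exact congrArg rr.toMap (H0 a)
  · exact congrArg tt.toMap (H0 a)
  · exact congrArg rr.toMap (H1 t)
  · exact congrArg tt.toMap (H1 t)

/-! ### Maps and homotopies on suspensions -/

namespace Susp

variable {A : PSpace.{u}} {X : PSpace.{w}}

theorem homotopic_of_continuous {f g : PMap (Susp A) X} (F : C(I × (A × I), X))
    (hF : ∀ s a t, (a = A.pt ∨ t = 0 ∨ t = 1) → F (s, (a, t)) = X.pt)
    (h0 : ∀ a t, F (0, (a, t)) = f.toMap (point a t))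
    (h1 : ∀ a t, F (1, (a, t)) = g.toMap (point a t)) : f.Homotopic g := by
  let G : I × Susp A → X := fun q =>
    Quotient.lift (s := collapseSetoid (suspSet A)) (fun p => F (q.1, p)) (by
      rintro p p' (rfl | ⟨hp, hp'⟩)
      · rfl
      · exact (hF q.1 p.1 p.2 hp).trans (hF q.1 p'.1 p'.2 hp').symm) q.2
  have hG : Continuous G :=
    (Collapse.isQuotientMap_mk (suspSet A)).continuous_lift_prod_right (Y := I) (g := G)
      F.continuous
  refine ⟨⟨⟨⟨G, hG⟩, ?_, ?_⟩, ?_⟩⟩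
  · intro p
    obtain ⟨⟨a, t⟩, rfl⟩ := (Collapse.isQuotientMap_mk (suspSet A)).surjective p
    exact h0 a t
  · intro p
    obtain ⟨⟨a, t⟩, rfl⟩ := (Collapse.isQuotientMap_mk (suspSet A)).surjective p
    exact h1 a t
  · rintro s p rfl
    exact (hF s A.pt 0 (Or.inl rfl)).trans f.map_pt.symm

/-- Homotopies of maps on `Σ(Y ⊔ *)`. -/
theorem homotopic_of_plus {Y : Type u} [TopologicalSpace Y] {f g : PMap (Susp (Plus Y)) X}
    (F : C((Y × I) × I, X)) (hF : ∀ y t s, (t = 0 ∨ t = 1) → F ((y, t), s) = X.pt)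
    (h0 : ∀ y t, F ((y, t), 0) = f.toMap (point (A := Plus Y) (Sum.inl y) t))
    (h1 : ∀ y t, F ((y, t), 1) = g.toMap (point (A := Plus Y) (Sum.inl y) t)) :
    f.Homotopic g := by
  let G : I × (Plus Y × I) → X := fun q =>
    Sum.elim (fun y => F ((y, q.2.2), q.1)) (fun _ => X.pt) q.2.1
  have hG : Continuous G := by
    have h2 : Continuous fun p : (Y ⊕ Unit) × (I × I) =>
        (Sum.elim (fun y => F ((y, p.2.2), p.2.1)) (fun _ => X.pt) p.1 : X) := by
      rw [← (Homeomorph.sumProdDistrib (X := Y) (Y := Unit) (Z := I × I)).symm.comp_continuous_iff']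
      refine continuous_sum_dom.2 ⟨?_, ?_⟩
      · exact (by fun_prop : Continuous fun p : Y × (I × I) => F ((p.1, p.2.2), p.2.1))
      · exact (continuous_const : Continuous fun _ : Unit × (I × I) => X.pt)
    exact h2.comp (by fun_prop : Continuous fun q : I × ((Y ⊕ Unit) × I) => (q.2.1, (q.1, q.2.2)))
  refine homotopic_of_continuous ⟨G, hG⟩ ?_ ?_ ?_
  · rintro s (y | y) t h
    · exact hF y t s (h.resolve_left Sum.inl_ne_inr)
    · rfl
  · rintro (y | y) t
    · exact h0 y t
    · exact (f.map_pt.symm.trans (congrArg f.toMap (point_eq_pt (Or.inl rfl)).symm))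
  · rintro (y | y) t
    · exact h1 y t
    · exact (g.map_pt.symm.trans (congrArg g.toMap (point_eq_pt (Or.inl rfl)).symm))

end Susp

/-! ### Maps and homotopies on the suspended pinched space. -/

theorem base_mem_lastAtBase {W : Type u} {w₀ : W} {k : ℕ} :
    (fun _ => w₀) ∈ lastAtBase W w₀ k := fun _ _ => rfl

section Pinched

variable {W : Type u} [TopologicalSpace W] {w₀ : W} {k : ℕ} {X : PSpace.{w}}

/-- Local compactness of E keeps the quotient map W^k → P_k a quotient map after taking the product
with E. -/
theorem continuous_lift_pinched {E : Type v} [TopologicalSpace E] [LocallyCompactSpace E]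
    (F : C((Fin k → W) × E, X)) (hF : ∀ y e, y ∈ lastAtBase W w₀ k → F (y, e) = X.pt) :
    ∃ G : C(Pinched W w₀ k × E, X),
      ∀ y e, G (Collapse.mk (lastAtBase W w₀ k) y, e) = F (y, e) := by
  let G : Collapse (lastAtBase W w₀ k) × E → X := fun q =>
    Quotient.lift (s := collapseSetoid (lastAtBase W w₀ k)) (fun p => F (p, q.2)) (by
      rintro p p' (rfl | ⟨hp, hp'⟩)
      · rfl
      · exact (hF p q.2 hp).trans (hF p' q.2 hp').symm) q.1
  have hG : Continuous G :=
    (Collapse.isQuotientMap_mk (lastAtBase W w₀ k)).continuous_lift_prod_left (Y := E) (g := G)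
      F.continuous
  exact ⟨⟨G, hG⟩, fun _ _ => rfl⟩

/-- Maps on `ΣP_k`. -/
theorem exists_susp_pinched_map (F : C((Fin k → W) × I, X))
    (hF : ∀ y t, (y ∈ lastAtBase W w₀ k ∨ t = 0 ∨ t = 1) → F (y, t) = X.pt) :
    ∃ f : PMap (Susp (Pinched W w₀ k)) X,
      ∀ y t, f.toMap (Susp.point (A := Pinched W w₀ k)
        (Collapse.mk (lastAtBase W w₀ k) y) t) = F (y, t) := by
  obtain ⟨G, hG⟩ := continuous_lift_pinched F fun y t h => hF y t (Or.inl h)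
  refine ⟨Susp.lift G ?_, hG⟩
  rintro a t (rfl | h)
  · exact (hG _ t).trans (hF _ t (Or.inl base_mem_lastAtBase))
  · obtain ⟨y, rfl⟩ := (Collapse.isQuotientMap_mk (lastAtBase W w₀ k)).surjective a
    exact (hG y t).trans (hF y t (Or.inr h))

/-- Homotopies of maps on `ΣP_k`. -/
theorem homotopic_of_pinched {f g : PMap (Susp (Pinched W w₀ k)) X}
    (F : C(((Fin k → W) × I) × I, X))
    (hF : ∀ y t s, (y ∈ lastAtBase W w₀ k ∨ t = 0 ∨ t = 1) → F ((y, t), s) = X.pt)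
    (h0 : ∀ y t, F ((y, t), 0) = f.toMap (Susp.point (A := Pinched W w₀ k)
      (Collapse.mk (lastAtBase W w₀ k) y) t))
    (h1 : ∀ y t, F ((y, t), 1) = g.toMap (Susp.point (A := Pinched W w₀ k)
      (Collapse.mk (lastAtBase W w₀ k) y) t)) : f.Homotopic g := by
  -- The factor I × I carries the suspension and the homotopy parameter together.
  obtain ⟨G, hG⟩ := continuous_lift_pinched (w₀ := w₀) (E := I × I)
    (F.comp ⟨fun p => ((p.1, p.2.1), p.2.2), by fun_prop⟩) fun y t h => hF y t.1 t.2 (Or.inl h)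
  have hG' : ∀ y t s, G (Collapse.mk (lastAtBase W w₀ k) y, (t, s)) = F ((y, t), s) :=
    fun y t s => hG y (t, s)
  refine Susp.homotopic_of_continuous
    (G.comp ⟨fun p : I × (Pinched W w₀ k × I) => (p.2.1, (p.2.2, p.1)), by fun_prop⟩) ?_ ?_ ?_
  · rintro s a t (rfl | h)
    · exact (hG' _ t s).trans (hF _ t s (Or.inl base_mem_lastAtBase))
    · obtain ⟨y, rfl⟩ := (Collapse.isQuotientMap_mk (lastAtBase W w₀ k)).surjective a
      exact (hG' y t s).trans (hF y t s (Or.inr h))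
  · intro a t
    obtain ⟨y, rfl⟩ := (Collapse.isQuotientMap_mk (lastAtBase W w₀ k)).surjective a
    exact (hG' y t 0).trans (h0 y t)
  · intro a t
    obtain ⟨y, rfl⟩ := (Collapse.isQuotientMap_mk (lastAtBase W w₀ k)).surjective a
    exact (hG' y t 1).trans (h1 y t)

end Pinched

/-! ### The splitting of the suspended power `Σ(W^k ⊔ *)` -/

section Power

variable (W : Type u) [TopologicalSpace W] (w₀ : W) (k : ℕ)

/-- The inclusion `W^(k-1) ⊔ * → W^k ⊔ *` that adds the last coordinate `w₀`. -/
def incl : PMap (Plus (Fin (k - 1) → W)) (Plus (Fin k → W)) :=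
  ⟨⟨Sum.map (fun x j => if h : j.val < k - 1 then x ⟨j.val, h⟩ else w₀) _root_.id,
    Continuous.sumMap (continuous_pi fun j => by split_ifs <;> fun_prop) continuous_id⟩, rfl⟩

variable {k}

theorem proj_comp_incl : (proj W k).comp (incl W w₀ k) = PMap.id _ := by
  ext (x | x)
  · refine congrArg Sum.inl (funext fun j => ?_)
    exact dif_pos j.2
  · rfl

theorem pinch_comp_incl : (pinch W w₀ k).comp (incl W w₀ k) = PMap.const _ _ := by
  ext (x | x)
  · refine Collapse.mk_eq (fun j hj => ?_) base_mem_lastAtBase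
    exact dif_neg (by omega)
  · rfl

variable {W w₀}

/-- The form with `Function.update` makes i ∘ p the value at w₀ of a family that moves the last
coordinate through W, to which homotopy extension in W applies. -/
theorem incl_proj (hk : 0 < k) (y : Fin k → W) :
    (incl W w₀ k).toMap ((proj W k).toMap (Sum.inl y)) =
      (Sum.inl (Function.update y ⟨k - 1, by omega⟩ w₀) : (Fin k → W) ⊕ Unit) := by
  refine congrArg Sum.inl (funext fun j => ?_)
  rw [Function.update_apply]
  by_cases h : j.val < k - 1
  · rw [if_neg (by rintro rfl; exact lt_irrefl _ h)]
    exact dif_pos h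
  · rw [if_pos (Fin.ext (by change j.val = k - 1; omega))]
    exact dif_neg h

/-- A class `γ` with `γ ∘ Σq = [Σ(i ∘ p)]⁻¹ [1]` is obtained from the homotopy extension property:
the right hand side is null-homotopic on `Σ(W^(k-1) ⊔ *)`. -/
theorem WellPointed.exists_suspSplitting (hW : WellPointed W w₀) (hk : 0 < k) :
    ∃ γ, SuspSplitting (incl W w₀ k) (proj W k) (pinch W w₀ k) γ := by
  obtain ⟨r, τ, hrτ, hr0, hr1⟩ := hW.exists_retraction
  let l : Fin k := ⟨k - 1, by omega⟩
  have mem_iff : ∀ y : Fin k → W, y ∈ lastAtBase W w₀ k → y l = w₀ := fun y hy =>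
    hy l (by change k - 1 + 1 = k; omega)
  let T : PSpace.{u} := Susp (Plus (Fin k → W))
  let S : PSpace.{u} := Susp (Plus (Fin (k - 1) → W))
  let i : PMap S T := Susp.map (incl W w₀ k)
  let q : PMap T (Susp (Pinched W w₀ k)) := Susp.map (pinch W w₀ k)
  -- A representative of [Σ(i ∘ p)]⁻¹ [1], to be deformed until it factors through Σq.
  let c : PMap T T := Susp.mul ((Susp.map ((incl W w₀ k).comp (proj W k))).comp (Susp.rev _))
    (PMap.id T)
  let pt : (Fin k → W) × I → T := fun y => Susp.point (A := Plus (Fin k → W)) (Sum.inl y.1) y.2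
  have hpt : Continuous pt := (Susp.continuous_point (A := Plus (Fin k → W))).comp
    ((continuous_inl.comp continuous_fst).prodMk continuous_snd)
  -- The last coordinate is freed as an independent variable; at w₀ this is c on the image of i ∘ p.
  let f : C(((Fin k → W) × I) × W, T) :=
    ⟨fun z => c.toMap (pt (Function.update z.1.1 l z.2, z.1.2)), by fun_prop⟩
  obtain ⟨F⟩ := Susp.rev_mul_homotopic (PMap.id S)
  let pt' : (Fin k → W) × I → S := fun y =>
    Susp.point (A := Plus (Fin (k - 1) → W)) ((proj W k).toMap (Sum.inl y.1)) y.2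
  have hpt' : Continuous pt' := (Susp.continuous_point (A := Plus (Fin (k - 1) → W))).comp
    (((proj W k).toMap.continuous.comp (continuous_inl.comp continuous_fst)).prodMk continuous_snd)
  -- The image under Σi of the standard null-homotopy F of [1]⁻¹ [1] on ΣB.
  let N : C(((Fin k → W) × I) × I, T) :=
    ⟨fun z => i.toMap (F (z.2, pt' z.1)), by fun_prop⟩
  have hci : c.comp i = i.comp (Susp.mul ((PMap.id S).comp (Susp.rev _)) (PMap.id S)) := by
    rw [Susp.mul_comp_map, Susp.comp_mul]
    refine congrArg₂ Susp.mul (Susp.hom_ext fun a t => ?_) rfl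
    change Susp.point ((incl W w₀ k).toMap (((proj W k).comp (incl W w₀ k)).toMap a)) _ = _
    rw [proj_comp_incl]
    rfl
  have hqi : q.comp i = PMap.const _ _ := by
    rw [Susp.map_comp, pinch_comp_incl, Susp.map_const]
  have hqc : q.comp c = (Susp.mul (PMap.const _ _) (PMap.id _)).comp q := by
    rw [Susp.comp_mul, Susp.mul_comp_map]
    refine congrArg₂ Susp.mul (Susp.hom_ext fun a t => ?_) rfl
    exact congrArg (fun m : PMap S (Susp (Pinched W w₀ k)) =>
      m.toMap (Susp.point ((proj W k).toMap a) (unitInterval.symm t))) hqi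
  have hN : ∀ y, f (y, w₀) = N (y, 0) := by
    rintro ⟨y, t⟩
    change c.toMap (pt (Function.update y l w₀, t)) = i.toMap (F (0, pt' (y, t)))
    rw [F.apply_zero]
    refine Eq.trans ?_ (congrArg (fun m : PMap S T => m.toMap (pt' (y, t))) hci)
    exact congrArg (fun a : Plus (Fin k → W) => c.toMap (Susp.point a t)) (incl_proj hk y).symm
  -- The pinch map kills the whole null-homotopy, not only its end; this lets q ∘ D descend to ΣP_k
  -- at every time.
  have hqN : ∀ z, q.toMap (N z) = (Susp (Pinched W w₀ k)).pt := by
    intro z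
    exact congrArg (fun m : PMap S (Susp (Pinched W w₀ k)) => m.toMap (F (z.2, pt' z.1))) hqi
  -- The extended homotopy: the retraction is evaluated at the last coordinate and the time. It
  -- starts at c and equals N where the last coordinate is w₀, so at time 1 it is constant there and
  -- defines γ.
  let D : C(((Fin k → W) × I) × I, T) :=
    ⟨fun z => if τ (z.1.1 l, z.2) = 0 then f (z.1, r (z.1.1 l, z.2))
      else N (z.1, τ (z.1.1 l, z.2)),
      (continuous_paste f N hN r τ hrτ).comp (by fun_prop :
        Continuous fun z : ((Fin k → W) × I) × I => (z.1, (z.1.1 l, z.2)))⟩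
  have hD : ∀ z, D z = if τ (z.1.1 l, z.2) = 0 then f (z.1, r (z.1.1 l, z.2))
      else N (z.1, τ (z.1.1 l, z.2)) := fun _ => rfl
  have hD0 : ∀ y t, D ((y, t), 0) = c.toMap (pt (y, t)) := by
    intro y t
    rw [hD, if_pos (hr0 _).2, (hr0 _).1]
    change c.toMap (pt (Function.update y l (y l), t)) = _
    rw [Function.update_eq_self]
  have hDl : ∀ y t s, y l = w₀ → D ((y, t), s) = N ((y, t), s) := by
    intro y t s hy
    simp only [hD, hy, (hr1 _).2, (hr1 _).1]
    split_ifs with hs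
    · rw [hs, hN]
    · rfl
  have hF : ∀ s, F (s, S.pt) = S.pt := fun s => (F.eq_fst s rfl).trans (PMap.map_pt _)
  have hDt : ∀ y t s, (t = 0 ∨ t = 1) → D ((y, t), s) = T.pt := by
    intro y t s ht
    rw [hD]
    split_ifs
    · exact (congrArg c.toMap (Susp.point_eq_pt (Or.inr ht))).trans c.map_pt
    · exact (congrArg (fun z => i.toMap (F (_, z))) (Susp.point_eq_pt (Or.inr ht))).trans
        ((congrArg i.toMap (hF _)).trans i.map_pt)
  have hN1 : ∀ y, N (y, 1) = T.pt := by
    intro y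
    change i.toMap (F (1, pt' y)) = T.pt
    rw [F.apply_one]
    exact i.map_pt
  obtain ⟨γ, hγ⟩ := exists_susp_pinched_map (w₀ := w₀)
    (D.comp ⟨fun z : (Fin k → W) × I => (z, (1 : I)), by fun_prop⟩) (by
      rintro y t (hy | ht)
      · exact (hDl y t 1 (mem_iff y hy)).trans (hN1 _)
      · exact hDt y t 1 ht)
  refine ⟨γ, proj_comp_incl W w₀, pinch_comp_incl W w₀, ?_, ?_⟩
  · refine Eq.symm (HClass.mk_eq_mk (f := c).2 ?_)
    refine Susp.homotopic_of_plus D hDt hD0 fun y t => ?_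
    exact (hγ y t).symm
  · refine Eq.trans (Eq.symm (HClass.mk_eq_mk (f := Susp.mul (PMap.const _ _) (PMap.id _)).2 ?_))
      (one_mul (HClass.mk (PMap.id (Susp (Pinched W w₀ k)))))
    -- The homotopy q ∘ D runs from q ∘ c = (1 · [id]) ∘ q to q ∘ γ ∘ q, and descends to ΣP_k.
    refine homotopic_of_pinched (q.toMap.comp D) ?_ ?_ ?_
    · rintro y t s (hy | ht)
      · exact (congrArg q.toMap (hDl y t s (mem_iff y hy))).trans (hqN _)
      · exact (congrArg q.toMap (hDt y t s ht)).trans q.map_pt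
    · intro y t
      exact (congrArg q.toMap (hD0 y t)).trans (congrArg
        (fun m : PMap T (Susp (Pinched W w₀ k)) => m.toMap (pt (y, t))) hqc)
    · intro y t
      exact (congrArg q.toMap (hγ y t)).symm
-- The co-multiplication and the co-action on the split Fox space.
/-- The map `ν_n` corresponds under `e` to the suspension co-multiplication. -/
theorem mk_foxComul_comp_foxSplit {n : ℕ}
    {α : PMap (Susp (Pinched W w₀ (n - 1))) (Wedge (Fox W (n - 1)) (Susp (Pinched W w₀ (n - 1))))}
    (hα : IsCoaction W w₀ n α) :
    let e : PMap (Susp (Plus (Fin (n - 1) → W))) (FoxWedge W w₀ n) := foxSplit W w₀ n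
    HClass.mk ((foxComul W w₀ n α).comp e) =
      HClass.mk ((Wedge.inl (FoxWedge W w₀ n) (FoxWedge W w₀ n)).comp e) *
        HClass.mk ((Wedge.inr (FoxWedge W w₀ n) (FoxWedge W w₀ n)).comp e) := by
  intro e
  let Q := FoxWedge W w₀ n
  let p := proj W (n - 1)
  let q := pinch W w₀ (n - 1)
  let j₁ : PMap (Susp (Plus (Fin (n - 1 - 1) → W))) Q := Wedge.inr _ _
  let j₂ : PMap (Susp (Pinched W w₀ (n - 1))) Q := Wedge.inl _ _
  let b₁ : FoxGroup W n (Wedge Q Q) := HClass.mk (((Wedge.inl Q Q).comp j₁).comp (Susp.map p))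
  let b₂ : FoxGroup W n (Wedge Q Q) := HClass.mk (((Wedge.inr Q Q).comp j₁).comp (Susp.map p))
  let a₁ : FoxGroup W n (Wedge Q Q) := HClass.mk (((Wedge.inl Q Q).comp j₂).comp (Susp.map q))
  let a₂ : FoxGroup W n (Wedge Q Q) := HClass.mk (((Wedge.inr Q Q).comp j₂).comp (Susp.map q))
  have h1 : HClass.mk ((foxComulOne W w₀ n).comp (Susp.map p)) = b₁ * b₂ :=
    map_mul (Susp.pull _ p) (HClass.mk ((Wedge.inl Q Q).comp j₁))
      (HClass.mk ((Wedge.inr Q Q).comp j₁))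
  have hα' : HClass.mk (((Wedge.desc ((Wedge.inr Q Q).comp j₁)
      ((Wedge.inl Q Q).comp j₂)).comp α).comp (Susp.map q)) = b₂⁻¹ * a₁ * b₂ := by
    let V := Wedge (Fox W (n - 1)) (Susp (Pinched W w₀ (n - 1)))
    let b : FoxGroup W n V := Susp.pull V p (HClass.mk (Wedge.inl _ _))
    let a : FoxGroup W n V := Susp.pull V q (HClass.mk (Wedge.inr _ _))
    -- This is `foxIncl` on the target of α. It puts the conjugating factor in the second copy of Q
    -- and the conjugated one in the first, so b⁻¹ a b becomes b₂⁻¹ a₁ b₂.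
    let k : PMap V (Wedge Q Q) := Wedge.desc ((Wedge.inr Q Q).comp j₁) ((Wedge.inl Q Q).comp j₂)
    have hk : Susp.push _ k (b⁻¹ * a * b) =
        (Susp.push _ k b)⁻¹ * Susp.push _ k a * Susp.push _ k b := by
      rw [map_mul, map_mul, map_inv]
    exact (congrArg (Susp.push _ k) hα).trans hk
  have h2 : HClass.mk ((foxComulTwo W w₀ n α).comp (Susp.map q)) = b₂⁻¹ * a₁ * b₂ * a₂ := by
    have h3 : foxComulTwo W w₀ n α = Susp.mul
        ((Wedge.desc ((Wedge.inr Q Q).comp j₁) ((Wedge.inl Q Q).comp j₂)).comp α)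
        ((Wedge.inr Q Q).comp j₂) :=
      congrArg (fun m => PMap.comp m (Susp.comul (Pinched W w₀ (n - 1))))
        (Wedge.comp_desc (foxIncl W w₀ n) _ _)
    rw [h3, Susp.mul_comp_map]
    exact congrArg (· * a₂) hα'
  have h3 : HClass.mk ((foxComul W w₀ n α).comp e) =
      HClass.mk ((foxComulOne W w₀ n).comp (Susp.map p)) *
        HClass.mk ((foxComulTwo W w₀ n α).comp (Susp.map q)) :=
    mk_comp_suspSplit p q (foxComul W w₀ n α)
  have h4 : HClass.mk ((Wedge.inl Q Q).comp e) = b₁ * a₁ :=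
    mk_comp_suspSplit p q (Wedge.inl Q Q)
  have h5 : HClass.mk ((Wedge.inr Q Q).comp e) = b₂ * a₂ :=
    mk_comp_suspSplit p q (Wedge.inr Q Q)
  refine h3.trans ?_
  rw [h1, h2]
  refine Eq.trans ?_ (congrArg₂ (· * ·) h4 h5).symm
  -- The conjugation in α is exactly what moves b₂ past a₁.
  change b₁ * b₂ * (b₂⁻¹ * a₁ * b₂ * a₂) = b₁ * a₁ * (b₂ * a₂)
  group

/-- The co-action `α` exists and is unique up to homotopy. -/
theorem SuspSplitting.exists_isCoaction {n : ℕ} {γ}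
    (S : SuspSplitting (incl W w₀ (n - 1)) (proj W (n - 1)) (pinch W w₀ (n - 1)) γ) :
    ∃ α, IsCoaction W w₀ n α ∧ ∀ β, IsCoaction W w₀ n β → β.Homotopic α := by
  let V := Wedge (Fox W (n - 1)) (Susp (Pinched W w₀ (n - 1)))
  let b : FoxGroup W n V := Susp.pull V (proj W (n - 1)) (HClass.mk (Wedge.inl _ _))
  let a : FoxGroup W n V := Susp.pull V (pinch W w₀ (n - 1)) (HClass.mk (Wedge.inr _ _))
  -- Since i^* kills a, it sends b⁻¹ a b to the product of an inverse and the element itself.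
  obtain ⟨α, hα⟩ := S.exists_comp_pinch (b⁻¹ * a * b) (by
    rw [map_mul, map_mul, map_inv, S.pull_incl_pull_pinch, mul_one, inv_mul_cancel])
  exact ⟨α, hα, fun β hβ => HClass.mk_eq_mk.1 (S.mk_eq_of_comp_pinch (hβ.trans hα.symm))⟩

end Power

/-! ### Co-multiplications that correspond to the suspension co-multiplication -/

section Comultiplication

variable {A Q : PSpace.{u}} {e : PMap (Susp A) Q} {μ : PMap Q (Wedge Q Q)}

/-- The two inclusions into Q ∨ Q form the universal pair: applying the homomorphism induced by (f,
g) gives the identity for every f and g. -/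
theorem inducesGroupStructure_of_comp
    (h : HClass.mk (μ.comp e) = HClass.mk ((Wedge.inl Q Q).comp e) *
      HClass.mk ((Wedge.inr Q Q).comp e)) : InducesGroupStructure e μ := fun _ f g =>
  (congrArg (Susp.push A (Wedge.desc f g)) h).trans (map_mul _ _ _)

theorem InducesGroupStructure.mk_comp (h : InducesGroupStructure e μ) :
    HClass.mk (μ.comp e) = HClass.mk ((Wedge.inl Q Q).comp e) *
      HClass.mk ((Wedge.inr Q Q).comp e) := by
  have h' := h _ (Wedge.inl Q Q) (Wedge.inr Q Q)
  rwa [Wedge.desc_inl_inr] at h'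

/-- The pairs (1, *) and (*, 1) turn the unit laws of [ΣA, Q] into the co-unit laws, once e is
cancelled. -/
theorem InducesGroupStructure.isComultiplication (h : InducesGroupStructure e μ)
    (he : e.IsHomotopyEquiv) : IsComultiplication μ :=
  ⟨HClass.mk_eq_mk.1 (HClass.mk_eq_of_comp_isHomotopyEquiv he ((h _ _ _).trans (mul_one _))),
    HClass.mk_eq_mk.1 (HClass.mk_eq_of_comp_isHomotopyEquiv he ((h _ _ _).trans (one_mul _)))⟩

theorem InducesGroupStructure.iff_homotopic (h : InducesGroupStructure e μ)
    (he : e.IsHomotopyEquiv) (ν : PMap Q (Wedge Q Q)) :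
    InducesGroupStructure e ν ↔ ν.Homotopic μ := by
  refine ⟨fun hν => ?_, fun hν => inducesGroupStructure_of_comp ?_⟩
  · exact HClass.mk_eq_mk.1
      (HClass.mk_eq_of_comp_isHomotopyEquiv he (hν.mk_comp.trans h.mk_comp.symm))
  · exact (HClass.mk_comp_right (HClass.mk_eq_mk.2 hν) e).trans h.mk_comp

end Comultiplication

end FoxSpace

theorem theorem2 (W : Type*) [TopologicalSpace W] (w₀ : W)
    (hW : FoxSpace.WellPointed W w₀) (n : ℕ) (hn : 1 < n) :
    (FoxSpace.foxSplit W w₀ n).IsHomotopyEquiv ∧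
    (∃ α, FoxSpace.IsCoaction W w₀ n α ∧
      ∀ β, FoxSpace.IsCoaction W w₀ n β → β.Homotopic α) ∧
    ∀ α, FoxSpace.IsCoaction W w₀ n α →
      FoxSpace.IsComultiplication (FoxSpace.foxComul W w₀ n α) ∧
      ((FoxSpace.foxComul W w₀ n α).comp (FoxSpace.foxSplit W w₀ n)).Homotopic
        ((FoxSpace.Wedge.map (FoxSpace.foxSplit W w₀ n) (FoxSpace.foxSplit W w₀ n)).comp
          (FoxSpace.Susp.comul (FoxSpace.Plus (Fin (n - 1) → W)))) ∧
      ∀ ν : FoxSpace.PMap (FoxSpace.FoxWedge W w₀ n)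
          (FoxSpace.Wedge (FoxSpace.FoxWedge W w₀ n) (FoxSpace.FoxWedge W w₀ n)),
        FoxSpace.InducesGroupStructure (A := FoxSpace.Plus (Fin (n - 1) → W))
            (FoxSpace.foxSplit W w₀ n) ν ↔
          ν.Homotopic (FoxSpace.foxComul W w₀ n α) := by
  -- The bound n > 1 guarantees that W^(n-1) has a last coordinate.
  obtain ⟨γ, S⟩ := hW.exists_suspSplitting (show 0 < n - 1 by omega)
  have he : (FoxSpace.foxSplit W w₀ n).IsHomotopyEquiv := S.isHomotopyEquiv
  refine ⟨he, S.exists_isCoaction, fun α hα => ?_⟩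
  have key := FoxSpace.mk_foxComul_comp_foxSplit hα
  have h := FoxSpace.inducesGroupStructure_of_comp key
  -- The product of the two inclusions composed with e is by definition the class of (e ∨ e) ∘ σ, so
  -- `key` is already the middle claim.
  exact ⟨h.isComultiplication he, FoxSpace.HClass.mk_eq_mk.1 key, h.iff_homotopic he⟩
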